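/- Let $G$ be a finite multigraph, possibly with loops and parallel edges, and let $0 \le \ell \le k$ be integers. Call $G$ *$(k,\ell)$-sparse* if every subgraph of $G$ with $n'$ vertices and $m' \ge 1$ edges satisfies $m' \le kn' - \ell$, and *$(k,\ell)$-tight* if it is $(k,\ell)$-sparse and has exactly $kn-\ell$ edges, where $n$ is its number of vertices. A *map-graph* is a graph that admits an orientation in which every vertex has out-degree exactly one. A *$(k,\ell)$-maps-and-trees decomposition* of $G$ is a partition of the edge set of $G$ into the edge sets of $k-\ell$ spanning subgraphs that are map-graphs and $\ell$ spanning trees. Then $G$ is $(k,\ell)$-tight if and only if $G$ has a $(k,\ell)$-maps-and-trees decomposition. In particular (the case $\ell = k$), $G$ is $(k,k)$-tight if and only if its edge set can be partitioned into the edge sets of $k$ spanning trees of $G$. -/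

import Mathlib

/-!
Sparse multigraphs and maps-and-trees decompositions. A graph is Mathlib's multigraph
`Graph α β` (loops and parallel edges allowed), with vertex set `V(G)` and edge set `E(G)`;
`H ≤ G` says that `H` is a subgraph of `G`, and `H ≤s G` that it is a spanning subgraph.
-/

namespace Graph

section MapsAndTrees

variable {α β : Type*}

/-- `G` is `(k, ℓ)`-sparse: every non-empty subgraph, with `n'` vertices and `m'` edges, satisfies
`m' ≤ k n' - ℓ` (an inequality of integers). As usual for sparsity counts, non-empty means having
at least one edge; for `ℓ ≤ k` the inequality is automatic for a subgraph with at least one vertex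
and no edges. -/
def IsSparse (G : Graph α β) (k ℓ : ℕ) : Prop :=
  ∀ H : Graph α β, H ≤ G → E(H).Nonempty →
    (E(H).ncard : ℤ) ≤ (k : ℤ) * (V(H).ncard : ℤ) - (ℓ : ℤ)

/-- `G` is `(k, ℓ)`-tight: it is `(k, ℓ)`-sparse and has exactly `k n - ℓ` edges, where `n` is its
number of vertices. -/
def IsTight (G : Graph α β) (k ℓ : ℕ) : Prop :=
  G.IsSparse k ℓ ∧ (E(G).ncard : ℤ) = (k : ℤ) * (V(G).ncard : ℤ) - (ℓ : ℤ)

/-- An orientation of `G`: every edge gets a tail and a head, which are its two ends (both are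
the same vertex if the edge is a loop). -/
structure EdgeOrientation (G : Graph α β) where
  tail : E(G) → α
  head : E(G) → α
  isLink : ∀ e : E(G), G.IsLink (e : β) (tail e) (head e)

/-- The out-degree of a vertex: the number of edges whose tail it is. -/
noncomputable def EdgeOrientation.outDegree {G : Graph α β} (O : G.EdgeOrientation) (v : α) : ℕ∞ :=
  {e : E(G) | O.tail e = v}.encard

/-- A map-graph: some orientation gives every vertex out-degree exactly one. -/
def IsMapGraph (G : Graph α β) : Prop :=
  ∃ O : G.EdgeOrientation, ∀ v ∈ V(G), O.outDegree v = 1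

/-- `G` has a cycle: for some `n`, there are `n + 1` distinct vertices and `n + 1` distinct edges
such that edge `i` joins vertex `i` to vertex `i + 1`, with indices modulo `n + 1`. A loop is a
cycle with one edge, and two parallel edges form a cycle with two edges. -/
def HasCycle (G : Graph α β) : Prop :=
  ∃ (n : ℕ) (v : Fin (n + 1) → α) (e : Fin (n + 1) → β),
    Function.Injective v ∧ Function.Injective e ∧ ∀ i, G.IsLink (e i) (v i) (v (i + 1))

/-- `G` is connected: it has a vertex and any two of its vertices are joined by a walk. -/
def IsConnected (G : Graph α β) : Prop :=
  V(G).Nonempty ∧ ∀ x ∈ V(G), ∀ y ∈ V(G), Relation.ReflTransGen G.Adj x y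

/-- A tree: a connected graph without cycles. -/
def IsTree (G : Graph α β) : Prop :=
  G.IsConnected ∧ ¬ G.HasCycle

/-- The subgraphs `H i` decompose `G`: they are pairwise edge-disjoint and every edge of `G`
belongs to one of them. -/
def IsDecomposition {ι : Type*} (G : Graph α β) (H : ι → Graph α β) : Prop :=
  (∀ i, H i ≤ G) ∧ (∀ i j, i ≠ j → Disjoint E(H i) E(H j)) ∧ (⋃ i, E(H i)) = E(G)

/-- `G` is a `(k, ℓ)`-maps-and-trees (meant for `ℓ ≤ k`): it decomposes into `k - ℓ` spanning
map-graphs and `ℓ` spanning trees, all edge-disjoint. -/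
def IsMapsAndTrees (G : Graph α β) (k ℓ : ℕ) : Prop :=
  ∃ (M : Fin (k - ℓ) → Graph α β) (T : Fin ℓ → Graph α β),
    G.IsDecomposition (Sum.elim M T) ∧
    (∀ i, M i ≤s G ∧ (M i).IsMapGraph) ∧
    (∀ j, T j ≤s G ∧ (T j).IsTree)

/-- `G` is a `k`-arborescence: it decomposes into `k` edge-disjoint spanning trees. -/
def IsArborescence (G : Graph α β) (k : ℕ) : Prop :=
  ∃ T : Fin k → Graph α β, G.IsDecomposition T ∧ ∀ j, T j ≤s G ∧ (T j).IsTree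

end MapsAndTrees

end Graph

/-!
A map-graph is the same as a `(1, 0)`-tight graph, by Hall's theorem, and a tree is the same as a
`(1, 1)`-tight graph. Splitting a `(k, ℓ)`-tight graph into `k - ℓ` map-graphs and `ℓ` trees thus
means splitting a tight graph into tight parts whose parameters add up to `(k, ℓ)`.

For an edge set `F` let `r F` be its rank in the graphic matroid and `n F` the number of ends of
its edges. Since `r F = n F - 1` if `F` is connected, and `n` and `r` are additive over connected
components, a graph is `(k, ℓ)`-sparse if and only if `|F| ≤ (k - ℓ) n F + ℓ r F` for all `F`. The
right-hand side is a polymatroid rank function that is additive in `(k, ℓ)`. Rado's theorem, which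
extends Hall's theorem from cardinality to polymatroids, therefore splits a sparse graph into
sparse parts, as in the matroid union theorem. If the graph is tight, then summing the edge counts
over the parts forces each of them to be tight.
-/

namespace MapsAndTrees

open scoped Graph

section Polymatroid

variable {X Y ι κ : Type*}

/-- A polymatroid rank function with values in `ℕ`: a normalized, monotone and submodular set
function. -/
structure IsPolymatroid (f : Set X → ℕ) : Prop where
  map_empty : f ∅ = 0
  mono : Monotone f
  submodular : ∀ A B, f (A ∪ B) + f (A ∩ B) ≤ f A + f B

namespace IsPolymatroid

theorem const_mul {f : Set X → ℕ} (hf : IsPolymatroid f) (c : ℕ) :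
    IsPolymatroid fun A ↦ c * f A where
  map_empty := by rw [hf.map_empty, mul_zero]
  mono _ _ h := Nat.mul_le_mul_left c (hf.mono h)
  submodular A B := by
    simpa only [mul_add] using Nat.mul_le_mul_left c (hf.submodular A B)

theorem sum {s : Finset κ} {f : κ → Set X → ℕ} (hf : ∀ i ∈ s, IsPolymatroid (f i)) :
    IsPolymatroid fun A ↦ ∑ i ∈ s, f i A where
  map_empty := Finset.sum_eq_zero fun i hi ↦ (hf i hi).map_empty
  mono _ _ h := Finset.sum_le_sum fun i hi ↦ (hf i hi).mono h
  submodular A B := by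
    simpa only [Finset.sum_add_distrib] using
      Finset.sum_le_sum fun i hi ↦ (hf i hi).submodular A B

theorem add {f g : Set X → ℕ} (hf : IsPolymatroid f) (hg : IsPolymatroid g) :
    IsPolymatroid fun A ↦ f A + g A where
  map_empty := by rw [hf.map_empty, hg.map_empty]
  mono _ _ h := add_le_add (hf.mono h) (hg.mono h)
  submodular A B := by linarith [hf.submodular A B, hg.submodular A B]

theorem comp_preimage {f : Set X → ℕ} (hf : IsPolymatroid f) (φ : X → Y) :
    IsPolymatroid fun A ↦ f (φ ⁻¹' A) where
  map_empty := hf.map_empty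
  mono _ _ h := hf.mono (Set.preimage_mono h)
  submodular A B := hf.submodular (φ ⁻¹' A) (φ ⁻¹' B)

theorem comp_image {f : Set Y → ℕ} (hf : IsPolymatroid f) (φ : X → Y) :
    IsPolymatroid fun A ↦ f (φ '' A) where
  map_empty := by rw [Set.image_empty, hf.map_empty]
  mono _ _ h := hf.mono (Set.image_mono h)
  submodular A B := by
    rw [Set.image_union]
    exact (Nat.add_le_add_left (hf.mono (Set.image_inter_subset φ A B)) _).trans
      (hf.submodular _ _)

variable {f : Set X → ℕ} {S : ι → Set X}

theorem ncard_lt_union_erase_or [Finite ι] (hf : IsPolymatroid f)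
    (hS : ∀ A : Set ι, A.ncard ≤ f (⋃ a ∈ A, S a)) (e : ι) {x y : X} (hxy : x ≠ y) :
    (∀ A : Set ι, e ∉ A → A.ncard < f (S e \ {x} ∪ ⋃ a ∈ A, S a)) ∨
      ∀ A : Set ι, e ∉ A → A.ncard < f (S e \ {y} ∪ ⋃ a ∈ A, S a) := by
  by_contra! ⟨⟨A, heA, hA⟩, B, heB, hB⟩
  have hunion : (A ∪ B).ncard + 1 ≤
      f ((S e \ {x} ∪ ⋃ a ∈ A, S a) ∪ (S e \ {y} ∪ ⋃ a ∈ B, S a)) := by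
    rw [← Set.ncard_insert_of_notMem (show e ∉ A ∪ B from not_or.mpr ⟨heA, heB⟩)]
    refine (hS _).trans (hf.mono ?_)
    rw [Set.biUnion_insert, Set.biUnion_union]
    grind
  have hinter : (A ∩ B).ncard ≤
      f ((S e \ {x} ∪ ⋃ a ∈ A, S a) ∩ (S e \ {y} ∪ ⋃ a ∈ B, S a)) := by
    refine (hS _).trans (hf.mono (Set.iUnion₂_subset fun a ha ↦ Set.subset_inter ?_ ?_))
    · exact Set.subset_union_of_subset_right (Set.subset_biUnion_of_mem ha.1) _
    · exact Set.subset_union_of_subset_right (Set.subset_biUnion_of_mem ha.2) _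
  have := hf.submodular (S e \ {x} ∪ ⋃ a ∈ A, S a) (S e \ {y} ∪ ⋃ a ∈ B, S a)
  have := Set.ncard_union_add_ncard_inter A B
  omega

open Classical in
theorem ncard_le_biUnion_update [Finite ι] (hS : ∀ A : Set ι, A.ncard ≤ f (⋃ a ∈ A, S a))
    {e : ι} {T : Set X} (hT : ∀ A : Set ι, e ∉ A → A.ncard < f (T ∪ ⋃ a ∈ A, S a)) (A : Set ι) :
    A.ncard ≤ f (⋃ a ∈ A, Function.update S e T a) := by
  have eqOn {B : Set ι} (heB : e ∉ B) :
      ⋃ a ∈ B, Function.update S e T a = ⋃ a ∈ B, S a :=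
    Set.iUnion₂_congr fun a ha ↦ Function.update_of_ne (ne_of_mem_of_not_mem ha heB) _ _
  by_cases he : e ∈ A
  · have heA : e ∉ A \ {e} := fun h ↦ h.2 rfl
    rw [← Set.insert_sdiff_self_of_mem he, Set.biUnion_insert, Function.update_self, eqOn heA,
      Set.ncard_insert_of_notMem heA]
    exact hT _ heA
  · rw [eqOn he]
    exact hS A

/-- **Rado's theorem**. -/
theorem exists_transversal [Finite ι] [Finite X] (hf : IsPolymatroid f)
    (hS : ∀ A : Set ι, A.ncard ≤ f (⋃ a ∈ A, S a)) :
    ∃ t : ι → X, (∀ e, t e ∈ S e) ∧ ∀ A : Set ι, A.ncard ≤ f (t '' A) := by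
  classical
  -- A minimal subfamily that still satisfies the hypothesis consists of singletons.
  obtain ⟨T, hTS, hT⟩ := exists_minimal_le_of_wellFoundedLT
    (fun T : ι → Set X ↦ ∀ A : Set ι, A.ncard ≤ f (⋃ a ∈ A, T a)) S hS
  have erase_not_good (e : ι) {x : X} (hx : x ∈ T e) :
      ¬ ∀ A : Set ι, e ∉ A → A.ncard < f (T e \ {x} ∪ ⋃ a ∈ A, T a) := fun h ↦ by
    have hle : Function.update T e (T e \ {x}) ≤ T :=
      update_le_self_iff.mpr Set.sdiff_subset
    have hge := hT.le_of_le (ncard_le_biUnion_update hT.prop h) hle e hx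
    rw [Function.update_self] at hge
    exact hge.2 rfl
  have nonempty (e : ι) : (T e).Nonempty := by
    by_contra hne
    have := hT.prop {e}
    rw [Set.ncard_singleton, Set.biUnion_singleton, Set.not_nonempty_iff_eq_empty.mp hne,
      hf.map_empty] at this
    omega
  have subsingleton (e : ι) : (T e).Subsingleton := by
    intro x hx y hy
    by_contra hxy
    exact (hf.ncard_lt_union_erase_or hT.prop e hxy).elim (erase_not_good e hx)
      (erase_not_good e hy)
  choose t ht using nonempty
  refine ⟨t, fun e ↦ hTS e (ht e), fun A ↦ (hT.prop A).trans (hf.mono ?_)⟩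
  exact Set.iUnion₂_subset fun a ha x hx ↦ ⟨a, ha, subsingleton a (ht a) hx⟩

theorem exists_coloring [Finite X] [Fintype κ] {r : κ → Set X → ℕ}
    (hr : ∀ i, IsPolymatroid (r i)) (h : ∀ A : Set X, A.ncard ≤ ∑ i, r i A) :
    ∃ c : X → κ, ∀ i, ∀ A ⊆ c ⁻¹' {i}, A.ncard ≤ r i A := by
  obtain ⟨t, ht, htr⟩ := exists_transversal (S := fun e : X ↦ {p : X × κ | p.1 = e})
    (sum (s := Finset.univ) fun i _ ↦ (hr i).comp_preimage fun e ↦ (e, i)) fun A ↦ by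
      simpa using h A
  refine ⟨fun e ↦ (t e).2, fun i A hA ↦ (htr A).trans_eq ?_⟩
  have fiber (j : κ) : (fun e ↦ (e, j)) ⁻¹' (t '' A) = {e ∈ A | (t e).2 = j} := by
    ext e
    constructor
    · rintro ⟨e', he', h'⟩
      obtain rfl : e' = e := (ht e').symm.trans (congrArg Prod.fst h')
      exact ⟨he', congrArg Prod.snd h'⟩
    · rintro ⟨he, rfl⟩
      exact ⟨e, he, Prod.ext (ht e) rfl⟩
  have fiber_self : {e ∈ A | (t e).2 = i} = A :=
    Set.Subset.antisymm (Set.sep_subset _ _) fun e he ↦ ⟨he, hA he⟩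
  have fiber_of_ne {j : κ} (hji : j ≠ i) : {e ∈ A | (t e).2 = j} = ∅ :=
    Set.eq_empty_of_forall_notMem fun e he ↦ hji (he.2.symm.trans (hA he.1))
  rw [Finset.sum_eq_single_of_mem i (Finset.mem_univ i), fiber, fiber_self]
  intro j _ hji
  rw [fiber, fiber_of_ne hji, (hr j).map_empty]

end IsPolymatroid

theorem isPolymatroid_finrank_span {K M : Type*} [DivisionRing K] [AddCommGroup M] [Module K M]
    (v : X → M) [FiniteDimensional K (Submodule.span K (Set.range v))] :
    IsPolymatroid fun A ↦ Module.finrank K (Submodule.span K (v '' A)) := by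
  have finiteDimensional (A : Set X) : FiniteDimensional K (Submodule.span K (v '' A)) :=
    Submodule.finiteDimensional_of_le (Submodule.span_mono (Set.image_subset_range v A))
  have mono {A B : Set X} (h : A ⊆ B) : Submodule.span K (v '' A) ≤ Submodule.span K (v '' B) :=
    Submodule.span_mono (Set.image_mono h)
  refine ⟨?_, fun A B h ↦ Submodule.finrank_mono (mono h), fun A B ↦ ?_⟩
  · rw [Set.image_empty, Submodule.span_empty, finrank_bot]
  · rw [Set.image_union, Submodule.span_union,
      ← Submodule.finrank_sup_add_finrank_inf_eq (Submodule.span K (v '' A))]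
    exact Nat.add_le_add_left (Submodule.finrank_mono
      (le_inf (mono Set.inter_subset_left) (mono Set.inter_subset_right))) _

end Polymatroid

section EndSet

variable {α β : Type*} {G H : Graph α β} {F F' : Set β}

/-- The set of ends of the edges in `F`. -/
def endSet (G : Graph α β) (F : Set β) : Set α :=
  {v | ∃ e ∈ F, G.Inc e v}

theorem endSet_mono (h : F ⊆ F') : endSet G F ⊆ endSet G F' :=
  fun _ ⟨e, he, hv⟩ ↦ ⟨e, h he, hv⟩

theorem endSet_union (G : Graph α β) (F F' : Set β) :
    endSet G (F ∪ F') = endSet G F ∪ endSet G F' := by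
  ext v
  simp only [endSet, Set.mem_union, Set.mem_ofPred_eq, or_and_right, exists_or]

theorem endSet_empty (G : Graph α β) : endSet G ∅ = ∅ :=
  Set.eq_empty_of_forall_notMem fun _ ⟨_, he, _⟩ ↦ he

theorem endSet_subset_vertexSet (G : Graph α β) (F : Set β) : endSet G F ⊆ V(G) :=
  fun _ ⟨_, _, hv⟩ ↦ hv.vertex_mem

theorem endSet_edgeSet_subset_vertexSet (hHG : H ≤ G) : endSet G E(H) ⊆ V(H) :=
  fun _ ⟨_, he, hv⟩ ↦ ((hHG.inc_congr he).mpr hv).vertex_mem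

theorem isPolymatroid_ncard_endSet (G : Graph α β) [Finite V(G)] :
    IsPolymatroid fun F ↦ (endSet G F).ncard := by
  have finite (F : Set β) : (endSet G F).Finite :=
    V(G).toFinite.subset (endSet_subset_vertexSet G F)
  refine ⟨?_, fun F F' h ↦ Set.ncard_le_ncard (endSet_mono h) (finite F'), fun F F' ↦ ?_⟩
  · rw [endSet_empty, Set.ncard_empty]
  · rw [endSet_union, ← Set.ncard_union_add_ncard_inter _ _ (finite F) (finite F')]
    refine Nat.add_le_add_left (Set.ncard_le_ncard ?_ ((finite F).inter_of_left _)) _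
    exact Set.subset_inter (endSet_mono Set.inter_subset_left) (endSet_mono Set.inter_subset_right)

end EndSet

section EdgeRank

variable {α β : Type*} {G : Graph α β} {F F' : Set β} {C W : Set α} {e : β} {x y : α}

open Classical in
/-- The column of `e` in the incidence matrix of `G` over the field with two elements: the sum of
the two ends of `e`, hence `0` for a loop (and, by convention, for `e ∉ E(G)`). -/
noncomputable def incidenceVector (G : Graph α β) (e : β) : α →₀ ZMod 2 :=
  if h : ∃ p : α × α, G.IsLink e p.1 p.2 then
    Finsupp.single h.choose.1 1 + Finsupp.single h.choose.2 1
  else 0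

/-- The span of the incidence vectors of the edges in `F`. -/
noncomputable def edgeSpan (G : Graph α β) (F : Set β) : Submodule (ZMod 2) (α →₀ ZMod 2) :=
  Submodule.span (ZMod 2) (incidenceVector G '' F)

/-- The rank of `F` in the graphic matroid of `G`, computed as the rank of a set of columns of the
incidence matrix. -/
noncomputable def edgeRank (G : Graph α β) (F : Set β) : ℕ :=
  Module.finrank (ZMod 2) (edgeSpan G F)

/-- The sum of the coordinates in `C`. It vanishes on the incidence vector of an edge exactly if
the edge does not leave `C`. -/
noncomputable def coordSum (C : Set α) : (α →₀ ZMod 2) →ₗ[ZMod 2] ZMod 2 :=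
  Finsupp.linearCombination (ZMod 2) (C.indicator 1)

theorem coordSum_single_of_mem (hx : x ∈ C) : coordSum C (Finsupp.single x 1) = 1 := by
  rw [coordSum, Finsupp.linearCombination_single, one_smul, Set.indicator_of_mem hx, Pi.one_apply]

theorem coordSum_single_of_notMem (hx : x ∉ C) : coordSum C (Finsupp.single x 1) = 0 := by
  rw [coordSum, Finsupp.linearCombination_single, one_smul, Set.indicator_of_notMem hx]

theorem incidenceVector_of_isLink (h : G.IsLink e x y) :
    incidenceVector G e = Finsupp.single x 1 + Finsupp.single y 1 := by
  have hex : ∃ p : α × α, G.IsLink e p.1 p.2 := ⟨(x, y), h⟩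
  rw [incidenceVector, dif_pos hex]
  rcases h.eq_and_eq_or_eq_and_eq hex.choose_spec with ⟨hx, hy⟩ | ⟨hx, hy⟩
  · rw [← hx, ← hy]
  · rw [← hx, ← hy, add_comm]

theorem incidenceVector_of_notMem (he : e ∉ E(G)) : incidenceVector G e = 0 :=
  dif_neg fun ⟨_, h⟩ ↦ he h.edge_mem

theorem edgeSpan_union (G : Graph α β) (F F' : Set β) :
    edgeSpan G (F ∪ F') = edgeSpan G F ⊔ edgeSpan G F' := by
  rw [edgeSpan, Set.image_union, Submodule.span_union, edgeSpan, edgeSpan]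

theorem incidenceVector_mem_edgeSpan (he : e ∈ F) : incidenceVector G e ∈ edgeSpan G F :=
  Submodule.subset_span (Set.mem_image_of_mem _ he)

theorem edgeSpan_le_iff {p : Submodule (ZMod 2) (α →₀ ZMod 2)} :
    edgeSpan G F ≤ p ↔
      ∀ e ∈ F, ∀ x y, G.IsLink e x y → Finsupp.single x 1 + Finsupp.single y 1 ∈ p := by
  rw [edgeSpan, Submodule.span_le, Set.image_subset_iff]
  refine forall₂_congr fun e _ ↦ ⟨fun h x y hxy ↦ ?_, fun h ↦ ?_⟩
  · rwa [← incidenceVector_of_isLink hxy]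
  · by_cases he : e ∈ E(G)
    · obtain ⟨x, y, hxy⟩ := Graph.exists_isLink_of_mem_edgeSet he
      rw [Set.mem_preimage, incidenceVector_of_isLink hxy]
      exact h x y hxy
    · rw [Set.mem_preimage, incidenceVector_of_notMem he]
      exact p.zero_mem

theorem edgeSpan_le_supported (G : Graph α β) (F : Set β) :
    edgeSpan G F ≤ Finsupp.supported (ZMod 2) (ZMod 2) (endSet G F) :=
  edgeSpan_le_iff.mpr fun e he _ _ h ↦ add_mem
    (Finsupp.single_mem_supported _ _ ⟨e, he, h.inc_left⟩)
    (Finsupp.single_mem_supported _ _ ⟨e, he, h.inc_right⟩)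

theorem edgeSpan_le_ker_coordSum (h : ∀ e ∈ F, ∀ x y, G.IsLink e x y → (x ∈ C ↔ y ∈ C)) :
    edgeSpan G F ≤ LinearMap.ker (coordSum C) := by
  refine edgeSpan_le_iff.mpr fun e he x y hxy ↦ ?_
  rw [LinearMap.mem_ker, map_add]
  by_cases hx : x ∈ C
  · rw [coordSum_single_of_mem hx, coordSum_single_of_mem ((h e he x y hxy).mp hx),
      CharTwo.add_self_eq_zero]
  · rw [coordSum_single_of_notMem hx,
      coordSum_single_of_notMem (hx ∘ (h e he x y hxy).mpr), add_zero]

theorem finrank_supported {R : Type*} [Ring R] [StrongRankCondition R] (W : Set α) :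
    Module.finrank R (Finsupp.supported R R W) = W.ncard := by
  rw [(Finsupp.supportedEquivFinsupp W).finrank_eq,
    Module.finrank_eq_nat_card_basis Finsupp.basisSingleOne, Nat.card_coe_set_eq]

theorem finite_supported {R : Type*} [Ring R] (hW : W.Finite) :
    Module.Finite R (Finsupp.supported R R W) :=
  have := hW.to_subtype
  Module.Finite.equiv (Finsupp.supportedEquivFinsupp W).symm

theorem finiteDimensional_edgeSpan (hW : (endSet G F).Finite) :
    FiniteDimensional (ZMod 2) (edgeSpan G F) :=
  have := finite_supported (R := ZMod 2) hW
  Submodule.finiteDimensional_of_le (edgeSpan_le_supported G F)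

theorem edgeRank_add_one_le (hW : W.Finite) (hne : W.Nonempty) (hF : endSet G F ⊆ W) :
    edgeRank G F + 1 ≤ W.ncard := by
  obtain ⟨w, hw⟩ := hne
  have hlt : edgeSpan G F < Finsupp.supported (ZMod 2) (ZMod 2) W := by
    refine SetLike.lt_iff_le_and_exists.mpr ⟨(edgeSpan_le_supported G F).trans
      (Finsupp.supported_mono hF), Finsupp.single w 1, Finsupp.single_mem_supported _ _ hw, ?_⟩
    intro hmem
    have := edgeSpan_le_ker_coordSum (C := Set.univ) (fun _ _ _ _ _ ↦ Iff.rfl) hmem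
    rw [LinearMap.mem_ker, coordSum_single_of_mem (Set.mem_univ w)] at this
    exact one_ne_zero this
  have := finite_supported (R := ZMod 2) hW
  rw [← finrank_supported (R := ZMod 2) W]
  exact Submodule.finrank_lt_finrank_of_lt hlt

theorem edgeRank_union_of_disjoint_endSet (hF : (endSet G F).Finite) (hF' : (endSet G F').Finite)
    (h : Disjoint (endSet G F) (endSet G F')) :
    edgeRank G (F ∪ F') = edgeRank G F + edgeRank G F' := by
  have hdisj : Disjoint (edgeSpan G F) (edgeSpan G F') :=
    (Finsupp.disjoint_supported_supported h).mono (edgeSpan_le_supported G F)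
      (edgeSpan_le_supported G F')
  have := finiteDimensional_edgeSpan hF
  have := finiteDimensional_edgeSpan hF'
  rw [edgeRank, edgeSpan_union, ← add_zero (Module.finrank _ _),
    ← finrank_bot (ZMod 2) (α →₀ ZMod 2), ← hdisj.eq_bot,
    Submodule.finrank_sup_add_finrank_inf_eq, edgeRank, edgeRank]

theorem edgeRank_le_ncard (hF : F.Finite) : edgeRank G F ≤ F.ncard := by
  have := (hF.image (incidenceVector G)).fintype
  refine (finrank_span_le_card _).trans ?_
  rw [← Set.ncard_eq_toFinset_card']
  exact Set.ncard_image_le hF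

theorem ncard_le_edgeRank_add_one {K : Graph α β} (hK : K.IsConnected) (hKG : K ≤ G)
    [Finite V(K)] :
    V(K).ncard ≤ edgeRank G E(K) + 1 := by
  obtain ⟨⟨w, hw⟩, hconn⟩ := hK
  have hspan : Finsupp.supported (ZMod 2) (ZMod 2) V(K) ≤
      edgeSpan G E(K) ⊔ Submodule.span (ZMod 2) {Finsupp.single w 1} := by
    rw [Finsupp.supported_eq_span_single, Submodule.span_le]
    rintro _ ⟨x, hx, rfl⟩
    rw [SetLike.mem_coe]
    induction hconn w hw x hx with
    | refl => exact Submodule.mem_sup_right (Submodule.mem_span_singleton_self _)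
    | tail _ hyz ih =>
      obtain ⟨e, he⟩ := hyz
      have hmem := incidenceVector_mem_edgeSpan (G := G) he.edge_mem
      rw [incidenceVector_of_isLink (he.mono hKG)] at hmem
      exact (Submodule.add_mem_iff_right _ (ih he.left_mem)).mp (Submodule.mem_sup_left hmem)
  have := finiteDimensional_edgeSpan (V(K).toFinite.subset (endSet_edgeSet_subset_vertexSet hKG))
  rw [← finrank_supported (R := ZMod 2) V(K)]
  calc Module.finrank (ZMod 2) (Finsupp.supported (ZMod 2) (ZMod 2) V(K))
    _ ≤ Module.finrank (ZMod 2)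
        ↥(edgeSpan G E(K) ⊔ Submodule.span (ZMod 2) {Finsupp.single w 1}) :=
      Submodule.finrank_mono hspan
    _ ≤ edgeRank G E(K) + Module.finrank (ZMod 2)
        (Submodule.span (ZMod 2) {(Finsupp.single w 1 : α →₀ ZMod 2)}) :=
      Submodule.finrank_add_le_finrank_add_finrank _ _
    _ = edgeRank G E(K) + 1 := by
      rw [finrank_span_singleton (Finsupp.single_ne_zero.mpr one_ne_zero)]

theorem isPolymatroid_edgeRank (G : Graph α β) [Finite V(G)] : IsPolymatroid (edgeRank G) := by
  have : FiniteDimensional (ZMod 2)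
      (Submodule.span (ZMod 2) (Set.range (incidenceVector G))) := by
    rw [← Set.image_univ]
    exact finiteDimensional_edgeSpan (V(G).toFinite.subset (endSet_subset_vertexSet G _))
  exact isPolymatroid_finrank_span (incidenceVector G)

end EdgeRank

section Component

variable {α β : Type*} {G : Graph α β} {x y z : α}

/-- The vertices that are joined to `x` by a walk in `G`, including `x` itself. -/
def component (G : Graph α β) (x : α) : Set α :=
  {y | Relation.ReflTransGen G.Adj x y}

theorem mem_component_self (G : Graph α β) (x : α) : x ∈ component G x :=
  .refl

theorem mem_component_iff_of_adj (h : G.Adj y z) : y ∈ component G x ↔ z ∈ component G x :=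
  ⟨fun hy ↦ hy.tail h, fun hz ↦ hz.tail h.symm⟩

theorem component_subset_vertexSet (hx : x ∈ V(G)) : component G x ⊆ V(G) := by
  intro y hy
  cases hy with
  | refl => exact hx
  | tail _ h => exact h.right_mem

theorem isConnected_induce_component (G : Graph α β) (x : α) :
    (G.induce (component G x)).IsConnected := by
  have reach {y : α} (hy : y ∈ component G x) :
      Relation.ReflTransGen (G.induce (component G x)).Adj x y := by
    have hy' : Relation.ReflTransGen G.Adj x y := hy
    induction hy' with
    | refl => exact .refl
    | tail hxy hyz ih =>
      obtain ⟨e, he⟩ := hyz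
      exact (ih hxy).tail ⟨e, he, hxy, hxy.tail he.adj⟩
  refine ⟨⟨x, mem_component_self G x⟩, fun y hy z hz ↦ ?_⟩
  exact (symm (reach hy)).trans (reach hz)

theorem edgeSet_eq_union_of_adj_closed {C : Set α} (hC : ∀ y z, G.Adj y z → (y ∈ C ↔ z ∈ C)) :
    E(G) = E(G.induce C) ∪ E(G.deleteVerts C) := by
  ext e
  rw [Graph.edgeSet_deleteVerts, Graph.edgeSet_induce]
  constructor
  · intro he
    obtain ⟨x, y, h⟩ := Graph.exists_isLink_of_mem_edgeSet he
    by_cases hx : x ∈ C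
    · exact .inl ⟨x, y, h, hx, (hC x y h.adj).mp hx⟩
    · exact .inr ⟨x, y, h, hx, hx ∘ (hC x y h.adj).mpr⟩
  · rintro (⟨x, y, h, -⟩ | ⟨x, y, h, -⟩) <;> exact h.edge_mem

end Component

section Sparse

variable {α β : Type*} {G H : Graph α β} {k ℓ : ℕ} {F : Set β}

theorem ncard_edgeSet_add_le (hG : G.IsSparse k ℓ) (hℓk : ℓ ≤ k) [Finite V(G)] (hHG : H ≤ G)
    (hH : V(H).Nonempty) : E(H).ncard + ℓ ≤ k * V(H).ncard := by
  obtain hE | hE := E(H).eq_empty_or_nonempty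
  · have := (Set.ncard_pos (V(G).toFinite.subset hHG.vertexSet_mono)).mpr hH
    rw [hE, Set.ncard_empty, zero_add]
    exact hℓk.trans (Nat.le_mul_of_pos_right k this)
  · have := hG H hHG hE
    omega

theorem ncard_add_le_mul_ncard_endSet (hG : G.IsSparse k ℓ) (hF : F ⊆ E(G)) (hne : F.Nonempty) :
    F.ncard + ℓ ≤ k * (endSet G F).ncard := by
  have hE : E((G.restrict F).induce (endSet G F)) = F := by
    refine Set.Subset.antisymm (fun e ⟨_, _, h, _⟩ ↦ h.1) fun e he ↦ ?_
    obtain ⟨x, y, h⟩ := Graph.exists_isLink_of_mem_edgeSet (hF he)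
    exact ⟨x, y, ⟨he, h⟩, ⟨e, he, h.inc_left⟩, ⟨e, he, h.inc_right⟩⟩
  have hle : (G.restrict F).induce (endSet G F) ≤ G :=
    (Graph.induce_le (G := G.restrict F) (endSet_subset_vertexSet G F)).trans Graph.restrict_le
  have := hG _ hle (hE.symm ▸ hne)
  rw [hE, Graph.vertexSet_induce] at this
  omega

theorem finite_edgeSet_of_isSparse [Finite V(G)] (hG : G.IsSparse k ℓ) : E(G).Finite := by
  by_contra hinf
  obtain ⟨F, hF, hcard⟩ := Set.Infinite.exists_subset_ncard_eq hinf (k * V(G).ncard + 1)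
  have hne : F.Nonempty := Set.nonempty_of_ncard_ne_zero (by omega)
  have := ncard_add_le_mul_ncard_endSet hG hF hne
  have := Nat.mul_le_mul_left k (Set.ncard_le_ncard (endSet_subset_vertexSet G F))
  omega

/-- The polymatroid whose value at an edge set that forms a connected subgraph with `n'` vertices
is `k n' - ℓ` (for `ℓ ≤ k`), so that it bounds the edge sets of `(k, ℓ)`-sparse graphs. -/
noncomputable def sparsityRank (G : Graph α β) (k ℓ : ℕ) (F : Set β) : ℕ :=
  (k - ℓ) * (endSet G F).ncard + ℓ * edgeRank G F

theorem isPolymatroid_sparsityRank (G : Graph α β) [Finite V(G)] (k ℓ : ℕ) :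
    IsPolymatroid (sparsityRank G k ℓ) :=
  ((isPolymatroid_ncard_endSet G).const_mul _).add ((isPolymatroid_edgeRank G).const_mul _)

theorem sum_sparsityRank {κ : Type*} (s : Finset κ) {k ℓ : κ → ℕ} (hℓk : ∀ i ∈ s, ℓ i ≤ k i)
    (G : Graph α β) (F : Set β) :
    ∑ i ∈ s, sparsityRank G (k i) (ℓ i) F =
      sparsityRank G (∑ i ∈ s, k i) (∑ i ∈ s, ℓ i) F := by
  simp only [sparsityRank, Finset.sum_add_distrib, ← Finset.sum_mul]
  rw [Finset.sum_tsub_distrib _ hℓk]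

theorem sparsityRank_add_le {W : Set α} (hℓk : ℓ ≤ k) (hW : W.Finite) (hne : W.Nonempty)
    (hF : endSet G F ⊆ W) : sparsityRank G k ℓ F + ℓ ≤ k * W.ncard := by
  calc sparsityRank G k ℓ F + ℓ
    _ = (k - ℓ) * (endSet G F).ncard + ℓ * (edgeRank G F + 1) := by rw [sparsityRank]; ring
    _ ≤ (k - ℓ) * W.ncard + ℓ * W.ncard := by
      gcongr
      exact edgeRank_add_one_le hW hne hF
    _ = k * W.ncard := by rw [← add_mul, Nat.sub_add_cancel hℓk]

theorem isSparse_of_ncard_le_sparsityRank (hℓk : ℓ ≤ k) [Finite V(G)] (hHG : H ≤ G)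
    (h : ∀ F ⊆ E(H), F.ncard ≤ sparsityRank G k ℓ F) : H.IsSparse k ℓ := by
  intro K hKH hK
  have hKG := hKH.trans hHG
  obtain ⟨e, he⟩ := hK
  obtain ⟨x, _, hx⟩ := Graph.exists_isLink_of_mem_edgeSet he
  have := h E(K) hKH.edgeSet_mono
  have := sparsityRank_add_le hℓk (V(G).toFinite.subset hKG.vertexSet_mono) ⟨x, hx.left_mem⟩
    (endSet_edgeSet_subset_vertexSet hKG)
  omega

theorem sparsityRank_union_of_disjoint_endSet {F' : Set β} (hF : (endSet G F).Finite)
    (hF' : (endSet G F').Finite) (h : Disjoint (endSet G F) (endSet G F')) :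
    sparsityRank G k ℓ (F ∪ F') = sparsityRank G k ℓ F + sparsityRank G k ℓ F' := by
  simp only [sparsityRank]
  rw [endSet_union, Set.ncard_union_eq h hF hF', edgeRank_union_of_disjoint_endSet hF hF' h]
  ring

theorem ncard_edgeSet_le_sparsityRank_of_isConnected (hG : G.IsSparse k ℓ) (hℓk : ℓ ≤ k)
    [Finite V(G)] (hHG : H ≤ G) (hH : H.IsConnected) (hE : E(H).Nonempty) :
    E(H).ncard ≤ sparsityRank G k ℓ E(H) := by
  have : Finite V(H) := (V(G).toFinite.subset hHG.vertexSet_mono).to_subtype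
  have hends := ncard_add_le_mul_ncard_endSet hG hHG.edgeSet_mono hE
  have hrank : (endSet G E(H)).ncard ≤ edgeRank G E(H) + 1 :=
    (Set.ncard_le_ncard (endSet_edgeSet_subset_vertexSet hHG)).trans
      (ncard_le_edgeRank_add_one hH hHG)
  refine Nat.le_of_add_le_add_right (b := ℓ) (hends.trans ?_)
  calc k * (endSet G E(H)).ncard
    _ = (k - ℓ) * (endSet G E(H)).ncard + ℓ * (endSet G E(H)).ncard := by
      rw [← add_mul, Nat.sub_add_cancel hℓk]
    _ ≤ (k - ℓ) * (endSet G E(H)).ncard + ℓ * (edgeRank G E(H) + 1) := by gcongr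
    _ = sparsityRank G k ℓ E(H) + ℓ := by rw [sparsityRank]; ring

theorem ncard_edgeSet_le_sparsityRank (hG : G.IsSparse k ℓ) (hℓk : ℓ ≤ k) [Finite V(G)]
    (hHG : H ≤ G) : E(H).ncard ≤ sparsityRank G k ℓ E(H) := by
  have finite_endSet (F : Set β) : (endSet G F).Finite :=
    V(G).toFinite.subset (endSet_subset_vertexSet G F)
  induction hn : E(H).ncard using Nat.strong_induction_on generalizing H with
  | _ n ih =>
    obtain hE | ⟨e, he⟩ := E(H).eq_empty_or_nonempty
    · rw [← hn, hE, Set.ncard_empty]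
      exact Nat.zero_le _
    -- Split off a connected component that contains an edge.
    obtain ⟨x, y, hxy⟩ := Graph.exists_isLink_of_mem_edgeSet he
    have hK : H.induce (component H x) ≤ H :=
      Graph.induce_le (component_subset_vertexSet hxy.left_mem)
    have hD : H.deleteVerts (component H x) ≤ H := Graph.deleteVerts_le
    have hmem : e ∈ E(H.induce (component H x)) :=
      ⟨x, y, hxy, mem_component_self H x, .single hxy.adj⟩
    have hends : Disjoint (endSet G E(H.induce (component H x)))
        (endSet G E(H.deleteVerts (component H x))) :=
      Set.disjoint_sdiff_right.mono (endSet_edgeSet_subset_vertexSet (hK.trans hHG))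
        (endSet_edgeSet_subset_vertexSet (hD.trans hHG))
    have hsplit := edgeSet_eq_union_of_adj_closed (C := component H x)
      fun _ _ ↦ mem_component_iff_of_adj
    have hfin : E(H).Finite := (finite_edgeSet_of_isSparse hG).subset hHG.edgeSet_mono
    have hlt : E(H.deleteVerts (component H x)).ncard < n := by
      rw [← hn]
      refine Set.ncard_lt_ncard ⟨hD.edgeSet_mono, fun h ↦ ?_⟩ hfin
      exact hends.notMem_of_mem_left ⟨e, hmem, hxy.mono hHG |>.inc_left⟩
        ⟨e, h he, hxy.mono hHG |>.inc_left⟩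
    rw [← hn, hsplit,
      sparsityRank_union_of_disjoint_endSet (finite_endSet _) (finite_endSet _) hends]
    exact (Set.ncard_union_le _ _).trans <| Nat.add_le_add
      (ncard_edgeSet_le_sparsityRank_of_isConnected hG hℓk (hK.trans hHG)
        (isConnected_induce_component H x) ⟨e, hmem⟩)
      (ih _ hlt (hD.trans hHG) rfl)

theorem ncard_le_sparsityRank (hG : G.IsSparse k ℓ) (hℓk : ℓ ≤ k) [Finite V(G)] (hF : F ⊆ E(G)) :
    F.ncard ≤ sparsityRank G k ℓ F := by
  have hE : E(G.restrict F) = F := Set.inter_eq_right.mpr hF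
  exact hE ▸ ncard_edgeSet_le_sparsityRank hG hℓk Graph.restrict_le

end Sparse

section MapGraph

variable {α β : Type*} {M : Graph α β}

theorem isMapGraph_iff_exists_bijective :
    M.IsMapGraph ↔ ∃ f : E(M) → V(M), f.Bijective ∧ ∀ e : E(M), M.Inc e (f e) := by
  constructor
  · rintro ⟨O, hO⟩
    refine ⟨fun e ↦ ⟨O.tail e, (O.isLink e).left_mem⟩, ?_, fun e ↦ (O.isLink e).inc_left⟩
    refine Function.bijective_iff_existsUnique _ |>.mpr fun v ↦ ?_
    obtain ⟨e, he⟩ := Set.encard_eq_one.mp (hO v v.2)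
    exact ⟨e, Subtype.ext (he.ge rfl), fun e' he' ↦ he.le (congrArg Subtype.val he')⟩
  · rintro ⟨f, hf, hinc⟩
    choose head hhead using hinc
    refine ⟨⟨fun e ↦ f e, head, hhead⟩, fun v hv ↦ Set.encard_eq_one.mpr ?_⟩
    obtain ⟨e, he, huniq⟩ := hf.existsUnique ⟨v, hv⟩
    refine ⟨e, Set.Subset.antisymm (fun e' he' ↦ huniq e' (Subtype.ext he')) ?_⟩
    exact Set.singleton_subset_iff.mpr (congrArg Subtype.val he)

theorem exists_injective_of_isSparse_one_zero [Finite V(M)] (hM : M.IsSparse 1 0) :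
    ∃ f : E(M) → V(M), f.Injective ∧ ∀ e : E(M), M.Inc e (f e) := by
  classical
  have := Fintype.ofFinite V(M)
  -- Sparsity is the condition of Hall's marriage theorem for the incidence relation.
  refine (Fintype.all_card_le_filter_rel_iff_exists_injective
    fun (e : E(M)) (v : V(M)) ↦ M.Inc e v).mp fun A ↦ ?_
  obtain rfl | hA := A.eq_empty_or_nonempty
  · exact Nat.zero_le _
  have hends : endSet M (Subtype.val '' (A : Set E(M))) =
      Subtype.val '' {v : V(M) | ∃ e ∈ A, M.Inc e v} := by
    ext v
    constructor
    · rintro ⟨_, ⟨e, he, rfl⟩, hv⟩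
      exact ⟨⟨v, hv.vertex_mem⟩, ⟨e, he, hv⟩, rfl⟩
    · rintro ⟨v, ⟨e, he, hv⟩, rfl⟩
      exact ⟨e, ⟨e, he, rfl⟩, hv⟩
  have hcount := ncard_add_le_mul_ncard_endSet hM (F := Subtype.val '' (A : Set E(M)))
    (Subtype.coe_image_subset _ _) (hA.to_set.image _)
  rwa [hends, Set.ncard_image_of_injective _ Subtype.val_injective,
    Set.ncard_image_of_injective _ Subtype.val_injective, Set.ncard_coe_finset,
    Set.ncard_eq_toFinset_card', Set.toFinset_ofPred, add_zero, one_mul] at hcount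

theorem isSparse_one_zero_of_injective [Finite V(M)] {f : E(M) → V(M)} (hf : f.Injective)
    (hinc : ∀ e : E(M), M.Inc e (f e)) : M.IsSparse 1 0 := by
  intro H hH _
  have : Finite V(H) := (V(M).toFinite.subset hH.vertexSet_mono).to_subtype
  have hmem (e : E(H)) : (f ⟨e, hH.edgeSet_mono e.2⟩ : α) ∈ V(H) :=
    ((hH.inc_congr e.2).mpr (hinc ⟨e, _⟩)).vertex_mem
  have hinj : Function.Injective fun e : E(H) ↦ (⟨f ⟨e, _⟩, hmem e⟩ : V(H)) := by
    intro e e' h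
    have h' := hf (Subtype.ext (Subtype.mk.inj h))
    exact Subtype.ext (Subtype.mk.inj h')
  have := Nat.card_le_card_of_injective _ hinj
  rw [Nat.card_coe_set_eq, Nat.card_coe_set_eq] at this
  omega

theorem isMapGraph_iff_isTight [Finite V(M)] : M.IsMapGraph ↔ M.IsTight 1 0 := by
  have hcard : (E(M).ncard : ℤ) = (1 : ℕ) * V(M).ncard - (0 : ℕ) ↔
      Nat.card E(M) = Nat.card V(M) := by
    rw [Nat.card_coe_set_eq, Nat.card_coe_set_eq]
    omega
  rw [isMapGraph_iff_exists_bijective, Graph.IsTight, hcard]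
  constructor
  · rintro ⟨f, hf, hinc⟩
    exact ⟨isSparse_one_zero_of_injective hf.injective hinc, Nat.card_eq_of_bijective f hf⟩
  · rintro ⟨hM, hcard⟩
    obtain ⟨f, hf, hinc⟩ := exists_injective_of_isSparse_one_zero hM
    exact ⟨f, hf.bijective_of_nat_card_le hcard.ge, hinc⟩

end MapGraph

theorem exists_injOn_path_of_reflTransGen {α : Type*} {r : α → α → Prop} [Std.Symm r] {x y : α}
    (h : Relation.ReflTransGen r x y) :
    ∃ (n : ℕ) (v : ℕ → α), v 0 = x ∧ v n = y ∧ Set.InjOn v (Set.Iic n) ∧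
      ∀ i < n, r (v i) (v (i + 1)) := by
  have hreach : (SimpleGraph.fromRel r).Reachable x y := by
    induction h with
    | refl => exact .rfl
    | @tail z w _ hzw ih =>
      obtain rfl | hne := eq_or_ne z w
      · exact ih
      · exact ih.trans ((SimpleGraph.fromRel_adj r z w).mpr ⟨hne, .inl hzw⟩).reachable
  obtain ⟨p, hp⟩ := hreach.exists_isPath
  refine ⟨p.length, p.getVert, p.getVert_zero, p.getVert_length, hp.getVert_injOn, fun i hi ↦ ?_⟩
  exact ((SimpleGraph.fromRel_adj r _ _).mp (p.adj_getVert_succ hi)).2.elim id symm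

section Tree

variable {α β : Type*} {T : Graph α β} {e : β} {x y : α}

theorem hasCycle_of_isLink_of_reflTransGen (he : T.IsLink e x y)
    (h : Relation.ReflTransGen (T.deleteEdges {e}).Adj x y) : T.HasCycle := by
  obtain ⟨n, v, rfl, rfl, hv, hadj⟩ := exists_injOn_path_of_reflTransGen h
  have hedge (i : ℕ) : ∃ f, i < n → f ≠ e ∧ T.IsLink f (v i) (v (i + 1)) := by
    by_cases hi : i < n
    · obtain ⟨f, hf⟩ := hadj i hi
      rw [Graph.deleteEdges_isLink] at hf
      exact ⟨f, fun _ ↦ ⟨hf.2, hf.1⟩⟩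
    · exact ⟨e, fun h ↦ absurd h hi⟩
  choose g hg using hedge
  have hv_inj {i j : ℕ} (hi : i ≤ n) (hj : j ≤ n) (hij : v i = v j) : i = j := hv hi hj hij
  have hg_inj {i j : ℕ} (hi : i < n) (hj : j < n) (hij : g i = g j) : i = j := by
    rcases (hg i hi).2.eq_and_eq_or_eq_and_eq (hij ▸ (hg j hj).2) with ⟨h, -⟩ | ⟨h, h'⟩
    · exact hv_inj hi.le hj.le h
    · have := hv_inj hi.le hj h
      have := hv_inj hi hj.le h'
      omega
  refine ⟨n, fun i ↦ v i, fun i ↦ if i.1 < n then g i else e, ?_, ?_, fun i ↦ ?_⟩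
  · exact fun i j hij ↦ Fin.ext (hv_inj i.is_le j.is_le hij)
  · intro i j hij
    dsimp only at hij
    split_ifs at hij with hi hj hj
    · exact Fin.ext (hg_inj hi hj hij)
    · exact absurd hij (hg i hi).1
    · exact absurd hij.symm (hg j hj).1
    · exact Fin.ext (by omega)
  · dsimp only
    split_ifs with hi
    · rw [Fin.val_add_one_of_lt (Fin.lt_def.mpr hi)]
      exact (hg i hi).2
    · obtain rfl : i = Fin.last n := Fin.ext (by rw [Fin.val_last]; omega)
      rw [Fin.last_add_one, Fin.val_last]
      exact he.symm

theorem reflTransGen_of_incidenceVector_mem_edgeSpan (he : T.IsLink e x y)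
    (h : incidenceVector T e ∈ edgeSpan T (E(T) \ {e})) :
    Relation.ReflTransGen (T.deleteEdges {e}).Adj x y := by
  by_contra hxy
  have hker := edgeSpan_le_ker_coordSum (C := component (T.deleteEdges {e}) x)
    (fun f hf u w hfl ↦
      mem_component_iff_of_adj ⟨f, (Graph.deleteEdges_isLink ..).mpr ⟨hfl, hf.2⟩⟩) h
  rw [LinearMap.mem_ker, incidenceVector_of_isLink he, map_add,
    coordSum_single_of_mem (mem_component_self _ x),
    coordSum_single_of_notMem (C := component _ x) hxy, add_zero] at hker
  exact one_ne_zero hker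

theorem linearIndepOn_incidenceVector (hT : ¬ T.HasCycle) :
    LinearIndepOn (ZMod 2) (incidenceVector T) E(T) := by
  refine linearIndepOn_iff_notMem_span.mpr fun e he hmem ↦ hT ?_
  obtain ⟨x, y, hxy⟩ := Graph.exists_isLink_of_mem_edgeSet he
  exact hasCycle_of_isLink_of_reflTransGen hxy
    (reflTransGen_of_incidenceVector_mem_edgeSpan hxy hmem)

theorem edgeRank_eq_ncard_of_not_hasCycle (hT : ¬ T.HasCycle) {F : Set β} (hF : F ⊆ E(T)) :
    edgeRank T F = F.ncard := by
  rw [Set.ncard_def, ← toENat_rank_span_set ((linearIndepOn_incidenceVector hT).mono hF),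
    Cardinal.toNat_toENat, edgeRank, edgeSpan, Module.finrank]

theorem isSparse_one_one_of_not_hasCycle [Finite V(T)] (hT : ¬ T.HasCycle) : T.IsSparse 1 1 := by
  refine isSparse_of_ncard_le_sparsityRank (G := T) le_rfl le_rfl fun F hF ↦ ?_
  rw [sparsityRank, edgeRank_eq_ncard_of_not_hasCycle hT hF, tsub_self, zero_mul, zero_add,
    one_mul]

theorem not_hasCycle_of_isSparse_one_one (hT : T.IsSparse 1 1) : ¬ T.HasCycle := by
  rintro ⟨n, v, e, hv, he, hlink⟩
  have hends : endSet T (Set.range e) ⊆ Set.range v := by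
    rintro w ⟨_, ⟨i, rfl⟩, hw⟩
    obtain rfl | rfl := hw.eq_or_eq_of_isLink (hlink i)
    exacts [⟨i, rfl⟩, ⟨i + 1, rfl⟩]
  have hcount := ncard_add_le_mul_ncard_endSet hT
    (Set.range_subset_iff.mpr fun i ↦ (hlink i).edge_mem) (Set.range_nonempty e)
  have hle := Set.ncard_le_ncard hends (Set.finite_range v)
  rw [← Set.image_univ, Set.ncard_image_of_injective _ he] at hcount
  rw [← Set.image_univ (f := v), Set.ncard_image_of_injective _ hv] at hle
  rw [Set.image_univ] at hcount
  omega

theorem isConnected_of_isTight {G : Graph α β} {k ℓ : ℕ} [Finite V(G)] (hG : G.IsTight k ℓ)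
    (hℓ : 0 < ℓ) (hℓk : ℓ ≤ k) : G.IsConnected := by
  obtain ⟨hsparse, hcard⟩ := hG
  replace hcard : E(G).ncard + ℓ = k * V(G).ncard := by zify; omega
  refine ⟨Set.nonempty_of_ncard_ne_zero fun h ↦ ?_, fun x hx y hy ↦ ?_⟩
  · rw [h] at hcard
    omega
  by_contra hxy
  have hC := component_subset_vertexSet hx
  have hin := ncard_edgeSet_add_le hsparse hℓk (Graph.induce_le hC) ⟨x, mem_component_self G x⟩
  have hout := ncard_edgeSet_add_le hsparse hℓk
    (Graph.deleteVerts_le (X := component G x)) ⟨y, hy, hxy⟩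
  have hE : E(G).ncard ≤ E(G.induce (component G x)).ncard +
      E(G.deleteVerts (component G x)).ncard :=
    (edgeSet_eq_union_of_adj_closed fun _ _ ↦ mem_component_iff_of_adj) ▸ Set.ncard_union_le _ _
  rw [Graph.vertexSet_induce] at hin
  rw [Graph.vertexSet_deleteVerts] at hout
  have hV := congrArg (k * ·) (Set.ncard_sdiff_add_ncard_of_subset hC)
  simp only [mul_add] at hV
  omega

theorem isTree_iff_isTight [Finite V(T)] : T.IsTree ↔ T.IsTight 1 1 := by
  constructor
  · rintro ⟨hconn, hacyc⟩
    have hsparse := isSparse_one_one_of_not_hasCycle hacyc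
    have hupper := ncard_edgeSet_add_le hsparse le_rfl le_rfl hconn.1
    have hlower := (ncard_le_edgeRank_add_one hconn le_rfl).trans
      (Nat.add_le_add_right (edgeRank_le_ncard (finite_edgeSet_of_isSparse hsparse)) 1)
    exact ⟨hsparse, by omega⟩
  · intro hT
    exact ⟨isConnected_of_isTight hT one_pos le_rfl, not_hasCycle_of_isSparse_one_one hT.1⟩

end Tree

section Decomposition

variable {α β κ : Type*} {G H : Graph α β} {K : κ → Graph α β} {k ℓ : κ → ℕ}

theorem finite_edgeSet_of_isDecomposition [Finite κ] [Finite V(G)] (hK : G.IsDecomposition K)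
    (hsparse : ∀ i, (K i).IsSparse (k i) (ℓ i)) : E(G).Finite := by
  rw [← hK.2.2]
  refine Set.finite_iUnion fun i ↦ ?_
  have : Finite V(K i) := (V(G).toFinite.subset (hK.1 i).vertexSet_mono).to_subtype
  exact finite_edgeSet_of_isSparse (hsparse i)

variable [Fintype κ]

theorem ncard_edgeSet_eq_sum_inf (hK : G.IsDecomposition K) (hHG : H ≤ G) (hH : E(H).Finite) :
    E(H).ncard = ∑ i, E(H ⊓ K i).ncard := by
  obtain ⟨hle, hdisj, hunion⟩ := hK
  have hinter (i : κ) : E(H ⊓ K i) = E(H) ∩ E(K i) :=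
    (Graph.Compatible.of_le_le hHG (hle i)).edgeSet_inf
  have hE : ⋃ i, E(H) ∩ E(K i) = E(H) := by
    rw [← Set.inter_iUnion, hunion, Set.inter_eq_left.mpr hHG.edgeSet_mono]
  simp only [hinter]
  rw [← finsum_eq_sum_of_fintype, ← Set.ncard_iUnion_of_finite, hE]
  · exact fun i ↦ hH.subset Set.inter_subset_left
  · exact fun i j hij ↦ (hdisj i j hij).mono Set.inter_subset_right Set.inter_subset_right

theorem ncard_edgeSet_eq_sum (hK : G.IsDecomposition K) (hG : E(G).Finite) :
    E(G).ncard = ∑ i, E(K i).ncard := by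
  simp only [ncard_edgeSet_eq_sum_inf hK le_rfl hG, inf_eq_right.mpr (hK.1 _)]

theorem isSparse_sum_of_isDecomposition [Finite V(G)] (hℓk : ∀ i, ℓ i ≤ k i)
    (hK : G.IsDecomposition K) (hspan : ∀ i, K i ≤s G) (hsparse : ∀ i, (K i).IsSparse (k i) (ℓ i)) :
    G.IsSparse (∑ i, k i) (∑ i, ℓ i) := by
  intro H hHG hH
  obtain ⟨e, he⟩ := hH
  obtain ⟨x, _, hx⟩ := Graph.exists_isLink_of_mem_edgeSet he
  have hfin := (finite_edgeSet_of_isDecomposition hK hsparse).subset hHG.edgeSet_mono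
  have hpart (i : κ) : E(H ⊓ K i).ncard + ℓ i ≤ k i * V(H).ncard := by
    have : Finite V(K i) := (hspan i).vertexSet_eq ▸ ‹Finite V(G)›
    have hVi : V(H ⊓ K i) = V(H) := by
      rw [Graph.vertexSet_inf, (hspan i).vertexSet_eq, Set.inter_eq_left.mpr hHG.vertexSet_mono]
    have := ncard_edgeSet_add_le (hsparse i) (hℓk i) (H := H ⊓ K i) inf_le_right
      (hVi.symm ▸ ⟨x, hx.left_mem⟩)
    rwa [hVi] at this
  have hsum := Finset.sum_le_sum fun i (_ : i ∈ Finset.univ) ↦ hpart i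
  rw [Finset.sum_add_distrib, ← Finset.sum_mul, ← ncard_edgeSet_eq_sum_inf hK hHG hfin] at hsum
  omega

theorem isTight_sum_iff_of_isDecomposition [Finite V(G)] (hℓk : ∀ i, ℓ i ≤ k i)
    (hK : G.IsDecomposition K) (hspan : ∀ i, K i ≤s G) (hsparse : ∀ i, (K i).IsSparse (k i) (ℓ i)) :
    G.IsTight (∑ i, k i) (∑ i, ℓ i) ↔ ∀ i, (K i).IsTight (k i) (ℓ i) := by
  have hfin := finite_edgeSet_of_isDecomposition hK hsparse
  have hcard : (E(G).ncard : ℤ) = (∑ i, k i : ℕ) * V(G).ncard - (∑ i, ℓ i : ℕ) ↔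
      ∀ i, (E(K i).ncard : ℤ) = k i * V(K i).ncard - ℓ i := by
    rw [ncard_edgeSet_eq_sum hK hfin]
    push_cast
    rw [Finset.sum_mul, ← Finset.sum_sub_distrib]
    simp only [(hspan _).vertexSet_eq]
    obtain hV | hV := V(G).eq_empty_or_nonempty
    · rw [eq_comm, Finset.sum_eq_sum_iff_of_le]
      · simp only [Finset.mem_univ, true_imp_iff, eq_comm]
      · intro i _
        rw [hV, Set.ncard_empty]
        omega
    · rw [Finset.sum_eq_sum_iff_of_le]
      · simp only [Finset.mem_univ, true_imp_iff]
      · intro i _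
        have : Finite V(K i) := (hspan i).vertexSet_eq ▸ ‹Finite V(G)›
        have := ncard_edgeSet_add_le (hsparse i) (hℓk i) le_rfl ((hspan i).vertexSet_eq ▸ hV)
        rw [(hspan i).vertexSet_eq] at this
        omega
  simp only [Graph.IsTight, hcard, isSparse_sum_of_isDecomposition hℓk hK hspan hsparse, hsparse,
    true_and]

theorem exists_isDecomposition_of_isSparse_sum [Finite V(G)] (hℓk : ∀ i, ℓ i ≤ k i)
    (hG : G.IsSparse (∑ i, k i) (∑ i, ℓ i)) :
    ∃ K : κ → Graph α β, G.IsDecomposition K ∧ ∀ i, K i ≤s G ∧ (K i).IsSparse (k i) (ℓ i) := by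
  have : Finite E(G) := (finite_edgeSet_of_isSparse hG).to_subtype
  obtain ⟨c, hc⟩ := IsPolymatroid.exists_coloring
    (fun i ↦ (isPolymatroid_sparsityRank G (k i) (ℓ i)).comp_image (Subtype.val : E(G) → β))
    fun A ↦ by
      rw [sum_sparsityRank _ fun i _ ↦ hℓk i,
        ← Set.ncard_image_of_injective A Subtype.val_injective]
      exact ncard_le_sparsityRank hG (Finset.sum_le_sum fun i _ ↦ hℓk i)
        (Subtype.coe_image_subset _ _)
  let K (i : κ) : Graph α β := G.restrict (Subtype.val '' (c ⁻¹' {i}))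
  have hE (i : κ) : E(K i) = Subtype.val '' (c ⁻¹' {i}) :=
    Set.inter_eq_right.mpr (Subtype.coe_image_subset _ _)
  refine ⟨K, ⟨fun i ↦ Graph.restrict_le, fun i j hij ↦ ?_, ?_⟩, fun i ↦ ⟨?_, ?_⟩⟩
  · rw [hE, hE]
    exact (Set.disjoint_image_iff Subtype.val_injective).mpr
      ((Set.disjoint_singleton.mpr hij).preimage c)
  · simp only [hE]
    rw [← Set.image_iUnion, ← Set.preimage_iUnion, Set.iUnion_of_singleton, Set.preimage_univ,
      Set.image_univ, Subtype.range_coe]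
  · exact ⟨Graph.restrict_le, rfl⟩
  · refine isSparse_of_ncard_le_sparsityRank (hℓk i) Graph.restrict_le fun F hF ↦ ?_
    rw [hE] at hF
    obtain ⟨A, hA, rfl⟩ := Set.subset_image_iff.mp hF
    rw [Set.ncard_image_of_injective _ Subtype.val_injective]
    exact hc i A hA

theorem isTight_sum_iff_exists_isDecomposition [Finite V(G)] (hℓk : ∀ i, ℓ i ≤ k i) :
    G.IsTight (∑ i, k i) (∑ i, ℓ i) ↔
      ∃ K : κ → Graph α β, G.IsDecomposition K ∧ ∀ i, K i ≤s G ∧ (K i).IsTight (k i) (ℓ i) := by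
  constructor
  · intro hG
    obtain ⟨K, hK, hpart⟩ := exists_isDecomposition_of_isSparse_sum hℓk hG.1
    have htight := (isTight_sum_iff_of_isDecomposition hℓk hK (fun i ↦ (hpart i).1)
      fun i ↦ (hpart i).2).mp hG
    exact ⟨K, hK, fun i ↦ ⟨(hpart i).1, htight i⟩⟩
  · rintro ⟨K, hK, hpart⟩
    exact (isTight_sum_iff_of_isDecomposition hℓk hK (fun i ↦ (hpart i).1)
      fun i ↦ (hpart i).2.1).mpr fun i ↦ (hpart i).2

end Decomposition

section Characterization

variable {α β : Type*} {G H : Graph α β} [Finite V(G)] {k ℓ : ℕ}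

theorem isMapGraph_iff_isTight_of_isSpanningSubgraph (hHG : H ≤s G) :
    H.IsMapGraph ↔ H.IsTight 1 0 :=
  have : Finite V(H) := hHG.vertexSet_eq ▸ ‹Finite V(G)›
  isMapGraph_iff_isTight

theorem isTree_iff_isTight_of_isSpanningSubgraph (hHG : H ≤s G) : H.IsTree ↔ H.IsTight 1 1 :=
  have : Finite V(H) := hHG.vertexSet_eq ▸ ‹Finite V(G)›
  isTree_iff_isTight

theorem isTight_iff_isMapsAndTrees (hℓk : ℓ ≤ k) : G.IsTight k ℓ ↔ G.IsMapsAndTrees k ℓ := by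
  let κ := Fin (k - ℓ) ⊕ Fin ℓ
  let d : κ → ℕ := Sum.elim (fun _ ↦ 0) fun _ ↦ 1
  have hd (i : κ) : d i ≤ 1 := by rcases i with _ | _ <;> simp [d]
  have hsum_one : ∑ _ : κ, 1 = k := by simp [κ, hℓk]
  have hsum_d : ∑ i, d i = ℓ := by simp [κ, d]
  have hmain := isTight_sum_iff_exists_isDecomposition (G := G) (k := fun _ ↦ 1) hd
  rw [hsum_one, hsum_d] at hmain
  rw [hmain]
  constructor
  · rintro ⟨K, hK, hpart⟩
    refine ⟨K ∘ Sum.inl, K ∘ Sum.inr, (Sum.elim_comp_inl_inr K).symm ▸ hK, fun i ↦ ?_, fun j ↦ ?_⟩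
    · exact (hpart (.inl i)).imp_right
        (isMapGraph_iff_isTight_of_isSpanningSubgraph (hpart (.inl i)).1).mpr
    · exact (hpart (.inr j)).imp_right
        (isTree_iff_isTight_of_isSpanningSubgraph (hpart (.inr j)).1).mpr
  · rintro ⟨M, T, hK, hM, hT⟩
    refine ⟨Sum.elim M T, hK, Sum.rec (fun i ↦ ?_) fun j ↦ ?_⟩
    · exact (hM i).imp_right (isMapGraph_iff_isTight_of_isSpanningSubgraph (hM i).1).mp
    · exact (hT j).imp_right (isTree_iff_isTight_of_isSpanningSubgraph (hT j).1).mp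

theorem isTight_self_iff_isArborescence : G.IsTight k k ↔ G.IsArborescence k := by
  have hmain := isTight_sum_iff_exists_isDecomposition (G := G) (κ := Fin k) (k := fun _ ↦ 1)
    (ℓ := fun _ ↦ 1) fun _ ↦ le_rfl
  rw [Fin.sum_const, smul_eq_mul, mul_one] at hmain
  rw [hmain]
  exact exists_congr fun T ↦ and_congr_right fun _ ↦ forall_congr' fun j ↦
    and_congr_right fun hj ↦ (isTree_iff_isTight_of_isSpanningSubgraph hj).symm

end Characterization

end MapsAndTrees

theorem mainTheorem5_general {α β : Type*} (G : Graph α β) (hV : G.vertexSet.Finite) (k : ℕ) :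
    (∀ ℓ : ℕ, ℓ ≤ k → (G.IsTight k ℓ ↔ G.IsMapsAndTrees k ℓ)) ∧
    (G.IsTight k k ↔ G.IsArborescence k) :=
  have : Finite G.vertexSet := hV.to_subtype
  ⟨fun _ hℓk ↦ MapsAndTrees.isTight_iff_isMapsAndTrees hℓk,
    MapsAndTrees.isTight_self_iff_isArborescence⟩

/-- For a finite multigraph and `0 ≤ ℓ ≤ k`, being `(k, ℓ)`-tight is equivalent to having a
`(k, ℓ)`-maps-and-trees decomposition; in particular the `(k, k)`-tight graphs are those that
decompose into `k` edge-disjoint spanning trees. -/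
theorem mainTheorem5 {α β : Type*} (G : Graph α β)
    (hV : G.vertexSet.Finite) (hE : G.edgeSet.Finite) (k : ℕ) :
    (∀ ℓ : ℕ, ℓ ≤ k → (G.IsTight k ℓ ↔ G.IsMapsAndTrees k ℓ)) ∧
    (G.IsTight k k ↔ G.IsArborescence k) :=
  mainTheorem5_general G hV k
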